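/- Let $G$ be a non-discrete compact (Hausdorff) abelian group with Haar measure $m$ normalized by $m(G)=1$, let $\widehat G$ be its dual group with counting measure, and let $1\le p\le 2$. For $f\in L^1(G)$ put $\widehat f(\gamma)=\int_G f(x)\,\overline{\gamma(x)}\,dm(x)$, and let $A_p(G)=\{f\in L^1(G): \widehat f\in \ell^p(\widehat G)\}$, a Banach algebra under convolution with norm $\|f\|_{A_p}=\|f\|_{L^1(G)}+\|\widehat f\|_{\ell^p(\widehat G)}$. Let $A_p(G)^1=\mathbb C\mathbf 1\oplus A_p(G)$ be its unitization, with norm $\|\lambda\mathbf 1+f\|=|\lambda|+\|f\|_{A_p}$, and for $x=\lambda\mathbf 1+f\in A_p(G)^1$ put $\widehat x(\gamma)=\lambda+\widehat f(\gamma)$, $\gamma\in\widehat G$. If $x\in A_p(G)^1$ and $\delta>0$ satisfy $\|x\|\le 1$ and $|\widehat x(\gamma)|\ge\delta$ for every $\gamma\in\widehat G$, then $x$ is invertible in $A_p(G)^1$ and $$\|x^{-1}\|\le\frac1\delta+\frac{2(1-\delta)}{\delta^2}.$$ -/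

import Mathlib

open MeasureTheory TopologicalSpace
open scoped ENNReal ComplexConjugate

noncomputable section

namespace FourierAlgebra

section L1

variable {G : Type*} [CommGroup G] [TopologicalSpace G] [IsTopologicalGroup G] [CompactSpace G]
  [MeasurableSpace G] [BorelSpace G]

variable (G) in
/-- Haar measure of a compact group, normalized to have total mass `1`. -/
abbrev haarProb : Measure G := Measure.haarMeasure (⊤ : PositiveCompacts G)

instance : IsProbabilityMeasure (haarProb G) :=
  ⟨by simpa using Measure.haarMeasure_self (K₀ := (⊤ : PositiveCompacts G))⟩

variable (G) in
/-- The Banach space `L¹(G)` of complex-valued functions. -/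
abbrev L1 : Type _ := Lp ℂ 1 (haarProb G)

/-- Translation `(τ_t g)(x) = g (t⁻¹ x)` on `L¹(G)`. -/
def translate (t : G) : L1 G →L[ℂ] L1 G :=
  LinearMap.mkContinuous
    { toFun := fun g => DomMulAct.mk t⁻¹ • g
      map_add' := fun f g => smul_add _ f g
      map_smul' := fun c g => smul_comm _ c g } 1
    (fun g => by simp [DomMulAct.norm_smul_Lp])

theorem translate_def (t : G) (g : L1 G) : translate t g = DomMulAct.mk t⁻¹ • g := rfl

theorem translate_ae_eq (t : G) (g : L1 G) :
    translate t g =ᵐ[haarProb G] fun x => g (t⁻¹ * x) :=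
  DomMulAct.smul_Lp_ae_eq (DomMulAct.mk t⁻¹) g

theorem norm_translate (t : G) (g : L1 G) : ‖translate t g‖ = ‖g‖ :=
  DomMulAct.norm_smul_Lp _ g

theorem translate_mul (s t : G) (g : L1 G) :
    translate (s * t) g = translate s (translate t g) := by
  simp only [translate_def, smul_smul, ← DomMulAct.mk_mul]
  rw [mul_inv]
  congr 1
  rw [mul_comm]

theorem continuous_translate (g : L1 G) : Continuous fun t : G => translate t g := by
  have h : Continuous fun t : G => DomMulAct.mk t⁻¹ :=
    DomMulAct.continuous_mk.comp continuous_inv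
  have : Fact ((1 : ℝ≥0∞) ≠ ∞) := ⟨ENNReal.one_ne_top⟩
  exact h.smul continuous_const

theorem integrable_coe (f : L1 G) : Integrable f (haarProb G) := L1.integrable_coeFn f

theorem integrable_smul_translate (f g : L1 G) :
    Integrable (fun t => f t • translate t g) (haarProb G) := by
  have hm : AEStronglyMeasurable (fun t : G => translate t g) (haarProb G) :=
    (continuous_translate g).stronglyMeasurable_of_hasCompactSupport
      (HasCompactSupport.of_compactSpace _) |>.aestronglyMeasurable
  exact (integrable_coe f).smul_bdd ‖g‖ hm
    (Filter.Eventually.of_forall fun t => (norm_translate t g).le)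

/-- Convolution on `L¹(G)`: `f * g = ∫ f(t) τ_t g dt`, a Bochner integral in `L¹(G)`; that is,
`(f * g)(x) = ∫ f(t) g(t⁻¹ x) dt`. -/
def conv (f g : L1 G) : L1 G := ∫ t, f t • translate t g ∂(haarProb G)

theorem conv_add (f g h : L1 G) : conv f (g + h) = conv f g + conv f h := by
  unfold conv
  rw [← integral_add (integrable_smul_translate f g) (integrable_smul_translate f h)]
  simp only [map_add, smul_add]

theorem add_conv (f g h : L1 G) : conv (f + g) h = conv f h + conv g h := by
  unfold conv
  rw [← integral_add (integrable_smul_translate f h) (integrable_smul_translate g h)]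
  refine integral_congr_ae ?_
  filter_upwards [Lp.coeFn_add f g] with t ht
  rw [ht, Pi.add_apply, add_smul]

theorem conv_smul (c : ℂ) (f g : L1 G) : conv f (c • g) = c • conv f g := by
  unfold conv
  rw [← integral_smul]
  simp only [map_smul, smul_comm c]

theorem smul_conv (c : ℂ) (f g : L1 G) : conv (c • f) g = c • conv f g := by
  unfold conv
  rw [← integral_smul]
  refine integral_congr_ae ?_
  filter_upwards [Lp.coeFn_smul c f] with t ht
  rw [ht, Pi.smul_apply, smul_assoc]

theorem norm_conv_le (f g : L1 G) : ‖conv f g‖ ≤ ‖f‖ * ‖g‖ := by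
  unfold conv
  refine (norm_integral_le_integral_norm _).trans ?_
  simp only [norm_smul, norm_translate]
  rw [integral_mul_const, ← L1.norm_eq_integral_norm]

/-- Convolution by `h` on the right, as a continuous linear map. -/
def convRight (h : L1 G) : L1 G →L[ℂ] L1 G :=
  LinearMap.mkContinuous
    { toFun := fun f => conv f h
      map_add' := fun f g => add_conv f g h
      map_smul' := fun c f => smul_conv c f h } ‖h‖
    (fun f => by simpa [mul_comm] using norm_conv_le f h)

theorem conv_translate (f g : L1 G) (s : G) :
    conv (translate s f) g = translate s (conv f g) := by
  unfold conv
  rw [← ContinuousLinearMap.integral_comp_comm _ (integrable_smul_translate f g),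
    ← integral_mul_left_eq_self (fun t => (translate s f) t • translate t g) s]
  refine integral_congr_ae ?_
  have h := (measurePreserving_mul_left (haarProb G) s).quasiMeasurePreserving.ae_eq
    (translate_ae_eq s f)
  filter_upwards [h] with t ht
  simp only [Function.comp_apply] at ht
  rw [ht, map_smul, translate_mul]
  simp

theorem conv_assoc (f g h : L1 G) : conv (conv f g) h = conv f (conv g h) := by
  change convRight h (conv f g) = _
  unfold conv
  rw [← ContinuousLinearMap.integral_comp_comm _ (integrable_smul_translate f g)]
  refine integral_congr_ae (Filter.Eventually.of_forall fun t => ?_)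
  simp only [map_smul]
  congr 1
  exact conv_translate g h t

/-- The Fourier transform `f̂(γ) = ∫ f(x) conj(γ(x)) dx` of `f ∈ L¹(G)` at `γ ∈ Ĝ`. -/
def fourier (f : L1 G) (γ : PontryaginDual G) : ℂ :=
  ∫ x, f x * conj (γ x : ℂ) ∂(haarProb G)

theorem integrable_fourier (f : L1 G) (γ : PontryaginDual G) :
    Integrable (fun x => f x * conj (γ x : ℂ)) (haarProb G) := by
  have hc : Continuous fun x : G => conj (γ x : ℂ) :=
    Complex.continuous_conj.comp (continuous_subtype_val.comp (map_continuous γ))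
  exact (integrable_coe f).mul_bdd (c := 1) hc.aestronglyMeasurable
    (Filter.Eventually.of_forall fun x => by
      simp only [RCLike.norm_conj, Circle.norm_coe, le_refl])

theorem fourier_add (f g : L1 G) : fourier (f + g) = fourier f + fourier g := by
  funext γ
  simp only [fourier, Pi.add_apply]
  rw [← integral_add (integrable_fourier f γ) (integrable_fourier g γ)]
  refine integral_congr_ae ?_
  filter_upwards [Lp.coeFn_add f g] with t ht
  rw [ht, Pi.add_apply, add_mul]

theorem fourier_smul (c : ℂ) (f : L1 G) : fourier (c • f) = c • fourier f := by
  funext γ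
  simp only [fourier, Pi.smul_apply]
  rw [← integral_smul]
  refine integral_congr_ae ?_
  filter_upwards [Lp.coeFn_smul c f] with t ht
  rw [ht, Pi.smul_apply, smul_mul_assoc]

theorem norm_fourier_le (f : L1 G) (γ : PontryaginDual G) : ‖fourier f γ‖ ≤ ‖f‖ := by
  refine (norm_integral_le_integral_norm _).trans ?_
  rw [L1.norm_eq_integral_norm]
  simp only [norm_mul, RCLike.norm_conj, Circle.norm_coe, mul_one, le_refl]

/-- Evaluation of the Fourier transform at `γ`, as a continuous linear functional. -/
def fourierAt (γ : PontryaginDual G) : L1 G →L[ℂ] ℂ :=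
  LinearMap.mkContinuous
    { toFun := fun f => fourier f γ
      map_add' := fun f g => congrFun (fourier_add f g) γ
      map_smul' := fun c f => congrFun (fourier_smul c f) γ } 1
    (fun f => by simpa using norm_fourier_le f γ)

theorem fourier_translate (t : G) (g : L1 G) (γ : PontryaginDual G) :
    fourier (translate t g) γ = conj (γ t : ℂ) * fourier g γ := by
  unfold fourier
  rw [← integral_const_mul,
    ← integral_mul_left_eq_self (fun x => (translate t g) x * conj (γ x : ℂ)) t]
  refine integral_congr_ae ?_
  have h := (measurePreserving_mul_left (haarProb G) t).quasiMeasurePreserving.ae_eq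
    (translate_ae_eq t g)
  filter_upwards [h] with x hx
  simp only [Function.comp_apply] at hx
  rw [hx, map_mul]
  simp
  ring

/-- The Fourier transform turns convolution into multiplication. -/
theorem fourier_conv (f g : L1 G) : fourier (conv f g) = fourier f * fourier g := by
  funext γ
  change fourierAt γ (conv f g) = fourier f γ * fourier g γ
  unfold conv
  rw [← ContinuousLinearMap.integral_comp_comm _ (integrable_smul_translate f g)]
  conv_rhs => rw [fourier, ← integral_mul_const]
  refine integral_congr_ae (Filter.Eventually.of_forall fun t => ?_)
  simp only [map_smul, smul_eq_mul]
  change _ * fourier (translate t g) γ = _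
  rw [fourier_translate, mul_assoc]

end L1

section Ap

variable (G : Type*) [CommGroup G] [TopologicalSpace G] [IsTopologicalGroup G] [CompactSpace G]
  [MeasurableSpace G] [BorelSpace G] (p : ℝ≥0∞)

/-- The subspace `{f ∈ L¹(G) : f̂ ∈ ℓᵖ(Ĝ)}` of `L¹(G)`. -/
def apSubmodule : Submodule ℂ (L1 G) where
  carrier := {f | Memℓp (fourier f) p}
  add_mem' {f g} hf hg := by
    simp only [Set.mem_ofPred_eq] at *
    rw [fourier_add]
    exact hf.add hg
  zero_mem' := by
    have h : fourier (0 : L1 G) = 0 := by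
      have := fourier_smul (0 : ℂ) (0 : L1 G)
      simpa using this
    simp only [Set.mem_ofPred_eq, h]
    exact zero_memℓp
  smul_mem' c f hf := by
    simp only [Set.mem_ofPred_eq] at *
    rw [fourier_smul]
    exact hf.const_smul c

/-- The algebra `A_p(G)` of all `f ∈ L¹(G)` with `f̂ ∈ ℓᵖ(Ĝ)`. It is a type synonym, since its norm
is not the one inherited from `L¹(G)`. -/
def Ap : Type _ := apSubmodule G p

instance : AddCommGroup (Ap G p) := inferInstanceAs (AddCommGroup (apSubmodule G p))

instance : Module ℂ (Ap G p) := inferInstanceAs (Module ℂ (apSubmodule G p))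

variable {G p}

/-- The inclusion of `A_p(G)` into `L¹(G)`. -/
def Ap.toL1 : Ap G p →ₗ[ℂ] L1 G := (apSubmodule G p).subtype

theorem Ap.toL1_injective : Function.Injective (Ap.toL1 : Ap G p → L1 G) :=
  Subtype.val_injective

/-- The Fourier transform of `f ∈ A_p(G)`, as an element of `ℓᵖ(Ĝ)`. -/
def Ap.hat : Ap G p →ₗ[ℂ] lp (fun _ : PontryaginDual G => ℂ) p where
  toFun f := ⟨fourier f.toL1, f.2⟩
  map_add' f g := by
    ext1
    exact (congrArg fourier (map_add Ap.toL1 f g)).trans (fourier_add _ _)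
  map_smul' c f := by
    ext1
    exact (congrArg fourier (map_smul Ap.toL1 c f)).trans (fourier_smul _ _)

theorem Ap.hat_apply (f : Ap G p) (γ : PontryaginDual G) : f.hat γ = fourier f.toL1 γ := rfl

/-- The norm `‖f‖ = ‖f‖₁ + ‖f̂‖_p` of `A_p(G)`. -/
instance : Norm (Ap G p) := ⟨fun f => ‖f.toL1‖ + ‖f.hat‖⟩

theorem Ap.norm_def (f : Ap G p) : ‖f‖ = ‖f.toL1‖ + ‖f.hat‖ := rfl

/-- Multiplication in `A_p(G)` is convolution. -/
instance : Mul (Ap G p) :=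
  ⟨fun f g => ⟨conv f.toL1 g.toL1, by
    change Memℓp (fourier (conv f.toL1 g.toL1)) p
    rw [fourier_conv]
    refine Memℓp.mono' (g := ‖f.toL1‖ • fourier g.toL1) (Memℓp.const_smul g.2 _) fun γ => ?_
    simp only [Pi.mul_apply, Pi.smul_apply, norm_mul, norm_smul, norm_norm]
    exact mul_le_mul_of_nonneg_right (norm_fourier_le _ _) (norm_nonneg _)⟩⟩

theorem Ap.toL1_mul (f g : Ap G p) : (f * g).toL1 = conv f.toL1 g.toL1 := rfl

variable [Fact (1 ≤ p)]

instance : NormedAddCommGroup (Ap G p) :=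
  NormedAddCommGroup.ofCore (𝕜 := ℂ)
    { norm_nonneg := fun f => add_nonneg (norm_nonneg _) (norm_nonneg _)
      norm_smul := fun c f => by
        simp only [Ap.norm_def, map_smul, norm_smul, mul_add]
      norm_triangle := fun f g => by
        simp only [Ap.norm_def, map_add]
        linarith [norm_add_le f.toL1 g.toL1, norm_add_le f.hat g.hat]
      norm_eq_zero_iff := fun f => by
        constructor
        · intro h
          rw [Ap.norm_def] at h
          have h1 : ‖f.toL1‖ = 0 := by
            linarith [norm_nonneg f.toL1, norm_nonneg f.hat]
          apply Ap.toL1_injective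
          rw [map_zero]
          exact norm_eq_zero.1 h1
        · rintro rfl
          simp [Ap.norm_def] }

theorem Ap.norm_mul_le' (f g : Ap G p) : ‖f * g‖ ≤ ‖f‖ * ‖g‖ := by
  have hp : p ≠ 0 := (zero_lt_one.trans_le (Fact.out : 1 ≤ p)).ne'
  have h1 : ‖(f * g).toL1‖ ≤ ‖f.toL1‖ * ‖g.toL1‖ := norm_conv_le _ _
  have h2 : ‖(f * g).hat‖ ≤ ‖f.toL1‖ * ‖g.hat‖ := by
    have h3 : ‖(f * g).hat‖ ≤ ‖((‖f.toL1‖ : ℝ) : ℂ) • g.hat‖ := by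
      refine lp.norm_mono hp fun γ => ?_
      have h4 : (f * g).hat γ = fourier f.toL1 γ * fourier g.toL1 γ :=
        congrFun (fourier_conv f.toL1 g.toL1) γ
      rw [h4, lp.coeFn_smul, Pi.smul_apply, norm_mul, norm_smul, Complex.norm_real, norm_norm]
      exact mul_le_mul_of_nonneg_right (norm_fourier_le _ _) (norm_nonneg _)
    rwa [norm_smul, Complex.norm_real, norm_norm] at h3
  have h5 : 0 ≤ ‖f.hat‖ * (‖g.toL1‖ + ‖g.hat‖) := by positivity
  simp only [Ap.norm_def]
  nlinarith

instance : NonUnitalNormedRing (Ap G p) where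
  dist_eq := dist_eq_norm_neg_add
  left_distrib f g h := Ap.toL1_injective (conv_add _ _ _)
  right_distrib f g h := Ap.toL1_injective (add_conv _ _ _)
  zero_mul f := Ap.toL1_injective (by
    have h := smul_conv (0 : ℂ) 0 f.toL1
    simpa [Ap.toL1_mul] using h)
  mul_zero f := Ap.toL1_injective (by
    have h := conv_smul (0 : ℂ) f.toL1 0
    simpa [Ap.toL1_mul] using h)
  mul_assoc f g h := Ap.toL1_injective (conv_assoc _ _ _)
  norm_mul_le := Ap.norm_mul_le'

instance : NormedSpace ℂ (Ap G p) where
  norm_smul_le c f := by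
    simp only [Ap.norm_def, map_smul, norm_smul, mul_add, le_refl]

instance : IsScalarTower ℂ (Ap G p) (Ap G p) :=
  ⟨fun c _ _ => Ap.toL1_injective (smul_conv c _ _)⟩

instance : SMulCommClass ℂ (Ap G p) (Ap G p) :=
  ⟨fun c _ _ => Ap.toL1_injective (conv_smul c _ _).symm⟩

variable (G p) in
/-- The unitization `A_p(G)¹ = ℂ𝟏 ⊕ A_p(G)` with norm `‖λ𝟏 + f‖ = |λ| + ‖f‖`. -/
abbrev ApUnit : Type _ := WithLp 1 (Unitization ℂ (Ap G p))

/-- For `x = λ𝟏 + f` in `A_p(G)¹`, the function `x̂(γ) = λ + f̂(γ)` on `Ĝ`. -/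
def ApUnit.hat (x : ApUnit G p) (γ : PontryaginDual G) : ℂ :=
  x.ofLp.fst + x.ofLp.snd.hat γ

end Ap

end FourierAlgebra

end

/-! Write `x = c𝟏 + f`. As `G` is not discrete, `Ĝ` is infinite, so `f̂ ∈ ℓᵖ` takes arbitrarily
small values and `|c| ≥ δ`; hence `‖f̂‖_p ≤ 1 - δ`. The inverse must have transform `1/x̂ = 1/c + a`
with `a = -f̂/(c x̂)`, so `‖a‖_p ≤ (1 - δ)/δ²`. Since `p ≤ 2`, `a` lies in `ℓ²` and is the transform
of some `g ∈ L²(G) ⊆ L¹(G)` with `‖g‖₁ ≤ ‖g‖₂ = ‖a‖₂ ≤ ‖a‖_p` (`exists_fourier_eq`,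
`lp_two_norm_le`). Thus `‖g‖ ≤ 2‖a‖_p`, which is the source of the factor 2, and `c⁻¹𝟏 + g` is the
inverse.

Two facts of harmonic analysis are needed: uniqueness of Fourier coefficients
(`eq_zero_of_fourier_eq_zero`) and infinitude of `Ĝ` (`discreteTopology_of_finite_dual`), the second
resting on the first. For uniqueness, let `f ≠ 0` act on `L²(G)` by a convolution operator `T ≠ 0`.
It is normal and commutes with translations, so Gelfand theory gives a character `φ` with `φ(T) ≠ 0`
on a commutative C⋆-algebra containing `T` and all translations. On translations `φ` is a continuous
character of `G`, and `T² = ∫ f(t) τ_t T dt` gives `φ(T)² = f̂(γ) φ(T)`, so `f̂(γ) ≠ 0`. -/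

noncomputable section

namespace FourierAlgebra

/-! ### Translation of continuous functions. -/

section Shift

variable {G : Type*} [CommGroup G] [TopologicalSpace G] [IsTopologicalGroup G]

/-- Translation `(τ_t k)(x) = k (t⁻¹ x)` on continuous functions. -/
def shift (t : G) (k : C(G, ℂ)) : C(G, ℂ) :=
  k.comp ⟨fun x => t⁻¹ * x, by fun_prop⟩

theorem shift_apply (t : G) (k : C(G, ℂ)) (x : G) : shift t k x = k (t⁻¹ * x) := rfl

theorem continuous_shift (k : C(G, ℂ)) : Continuous fun t : G => shift t k :=
  (ContinuousMap.curry ⟨fun q : G × G => k (q.1⁻¹ * q.2), by fun_prop⟩).continuous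

theorem norm_shift_le [CompactSpace G] (t : G) (k : C(G, ℂ)) : ‖shift t k‖ ≤ ‖k‖ :=
  (ContinuousMap.norm_le _ (norm_nonneg k)).2 fun _ => k.norm_coe_le_norm _

end Shift

/-! ### Convolution with continuous functions; approximation of the identity. -/

section Convolution

variable {G : Type*} [CommGroup G] [TopologicalSpace G] [IsTopologicalGroup G] [CompactSpace G]
  [MeasurableSpace G] [BorelSpace G]

theorem integrable_smul_of_continuous {E : Type*} [NormedAddCommGroup E] [NormedSpace ℂ E]
    (f : L1 G) {F : G → E} (hF : Continuous F) {C : ℝ} (hC : ∀ t, ‖F t‖ ≤ C) :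
    Integrable (fun t => f t • F t) (haarProb G) :=
  (integrable_coe f).smul_bdd C
    ((hF.stronglyMeasurable_of_hasCompactSupport
      (HasCompactSupport.of_compactSpace _)).aestronglyMeasurable)
    (Filter.Eventually.of_forall hC)

/-- Convolution of an integrable function with a continuous one, as a continuous function. -/
def convC (f : L1 G) (k : C(G, ℂ)) : C(G, ℂ) := ∫ t, f t • shift t k ∂(haarProb G)

theorem integrable_smul_shift (f : L1 G) (k : C(G, ℂ)) :
    Integrable (fun t => f t • shift t k) (haarProb G) :=
  integrable_smul_of_continuous f (continuous_shift k) fun t => norm_shift_le t k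

theorem convC_apply (f : L1 G) (k : C(G, ℂ)) (x : G) :
    convC f k x = ∫ t, f t * k (t⁻¹ * x) ∂(haarProb G) := by
  change ContinuousMap.evalCLM ℂ x (convC f k) = _
  unfold convC
  rw [← ContinuousLinearMap.integral_comp_comm _ (integrable_smul_shift f k)]
  rfl

/-- The class in `L¹(G)` of a continuous function. -/
abbrev toL1 : C(G, ℂ) →L[ℂ] L1 G := ContinuousMap.toLp 1 (haarProb G) ℂ

theorem toL1_shift (t : G) (k : C(G, ℂ)) : toL1 (shift t k) = translate t (toL1 k) := by
  refine Lp.ext ?_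
  have h := (measurePreserving_mul_left (haarProb G) t⁻¹).quasiMeasurePreserving.ae_eq
    (ContinuousMap.coeFn_toLp (p := 1) (𝕜 := ℂ) (haarProb G) k)
  filter_upwards [translate_ae_eq t (toL1 k), h,
    ContinuousMap.coeFn_toLp (p := 1) (𝕜 := ℂ) (haarProb G) (shift t k)] with x h1 h2 h3
  rw [h1, h3]
  exact h2.symm

theorem toL1_convC (f : L1 G) (k : C(G, ℂ)) : toL1 (convC f k) = conv f (toL1 k) := by
  unfold convC conv
  rw [← ContinuousLinearMap.integral_comp_comm _ (integrable_smul_shift f k)]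
  simp only [map_smul, toL1_shift]

/-- Convolution as a continuous bilinear map. -/
def convL : L1 G →L[ℂ] L1 G →L[ℂ] L1 G :=
  LinearMap.mkContinuous₂ (LinearMap.mk₂ ℂ conv add_conv smul_conv conv_add conv_smul) 1
    fun f g => by simpa using norm_conv_le f g

variable [T2Space G]

theorem denseRange_toL1 : DenseRange (toL1 : C(G, ℂ) → L1 G) :=
  ContinuousMap.toLp_denseRange ℂ (haarProb G) ℂ ENNReal.one_ne_top

/-- The substitution `t ↦ x/t`, carried out pointwise; density then gives commutativity on `L¹(G)`.
-/
theorem convC_comm (u v : C(G, ℂ)) : convC (toL1 u) v = convC (toL1 v) u := by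
  ext x
  rw [convC_apply, convC_apply,
    ← integral_div_left_eq_self (fun t => (toL1 v) t * u (t⁻¹ * x)) (haarProb G) x]
  have h := (Measure.measurePreserving_div_left (haarProb G) x).quasiMeasurePreserving.ae_eq
    (ContinuousMap.coeFn_toLp (p := 1) (𝕜 := ℂ) (haarProb G) v)
  refine integral_congr_ae ?_
  filter_upwards [ContinuousMap.coeFn_toLp (p := 1) (𝕜 := ℂ) (haarProb G) u, h] with t h1 h2
  simp only [Function.comp_apply] at h2
  rw [h1, h2, mul_comm]
  congr 2
  · rw [div_eq_mul_inv, mul_comm]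
  · simp

theorem conv_comm (f g : L1 G) : conv f g = conv g f := by
  refine denseRange_toL1.induction_on₂ (p := fun f g => conv f g = conv g f) ?_ ?_ f g
  · exact isClosed_eq ((convL (G := G)).continuous₂)
      ((convL (G := G)).continuous₂.comp continuous_swap)
  · intro u v
    rw [← toL1_convC, ← toL1_convC, convC_comm]

/-- Convolutions with averages over small neighbourhoods of `1` approximate a function, so a
function annihilated by all convolutions vanishes. -/
theorem eq_zero_of_conv_eq_zero {f : L1 G} (h : ∀ k : C(G, ℂ), conv f (toL1 k) = 0) : f = 0 := by
  have h' : ∀ k : L1 G, conv k f = 0 := fun k => by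
    rw [conv_comm]
    refine denseRange_toL1.induction_on (p := fun k => conv f k = 0) k ?_ h
    exact isClosed_eq (convL f).continuous continuous_const
  by_contra hf
  have hpos : 0 < ‖f‖ := norm_pos_iff.2 hf
  have h1 : translate (1 : G) f = f := by simp [translate_def]
  -- The contradiction comes from `∫_V (τ_t f - f) dt`: it equals `-m(V) f`, yet its integrand has
  -- norm `< ‖f‖` throughout `V`.
  set V : Set G := {t | ‖translate t f - f‖ < ‖f‖} with hV
  have hVo : IsOpen V :=
    isOpen_lt ((continuous_translate f).sub continuous_const).norm continuous_const
  have hV1 : (1 : G) ∈ V := by simp [hV, h1, hpos]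
  set k : L1 G := indicatorConstLp 1 hVo.measurableSet (measure_ne_top _ _) (1 : ℂ)
  have hk : ∫ t in V, translate t f ∂(haarProb G) = 0 := by
    rw [← h' k, conv, ← integral_indicator hVo.measurableSet]
    refine integral_congr_ae ?_
    filter_upwards [indicatorConstLp_coeFn (p := 1) (hs := hVo.measurableSet)
      (hμs := measure_ne_top (haarProb G) V) (c := (1 : ℂ))] with t ht
    rw [ht]
    by_cases htV : t ∈ V <;> simp [htV]
  have hint : Integrable (fun t => translate t f) (haarProb G) :=
    (continuous_translate f).integrable_of_hasCompactSupport
      (HasCompactSupport.of_compactSpace _)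
  have hsub : ∫ t in V, (translate t f - f) ∂(haarProb G) = -((haarProb G).real V • f) := by
    rw [integral_sub hint.integrableOn (integrable_const f), hk, setIntegral_const]
    simp
  -- Strictness survives integration because the open set `V` contains `1` and so has positive Haar
  -- measure.
  have hlt : ‖∫ t in V, (translate t f - f) ∂(haarProb G)‖ <
      ∫ t in V, ‖f‖ ∂(haarProb G) := by
    refine (norm_integral_le_integral_norm _).trans_lt ?_
    have hi : IntegrableOn (fun t => ‖translate t f - f‖) V (haarProb G) :=
      (hint.sub (integrable_const f)).norm.integrableOn
    rw [← sub_pos, ← integral_sub (integrable_const _) hi]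
    rw [setIntegral_pos_iff_support_of_nonneg_ae]
    · have : V ⊆ Function.support (fun t => ‖f‖ - ‖translate t f - f‖) ∩ V := fun t ht =>
        ⟨(sub_pos.2 ht).ne', ht⟩
      exact (hVo.measure_pos _ ⟨1, hV1⟩).trans_le (measure_mono this)
    · exact (ae_restrict_iff' hVo.measurableSet).2
        (Filter.Eventually.of_forall fun t ht => (sub_pos.2 ht).le)
    · exact (integrable_const _).sub hi
  rw [hsub, norm_neg, norm_smul, setIntegral_const, smul_eq_mul, Real.norm_of_nonneg measureReal_nonneg] at hlt
  exact lt_irrefl _ hlt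

end Convolution

/-! ### Gelfand theory for commuting normal elements. -/

/-- In a C⋆-algebra, a nonzero element of a family of commuting normal elements is detected by a
character of a closed subalgebra containing the family. -/
theorem exists_character_ne_zero {B : Type*} [CStarAlgebra B] {S : Set B}
    (hcomm : ∀ a ∈ S, ∀ b ∈ S, a * b = b * a)
    (hstar : ∀ a ∈ S, ∀ b ∈ S, a * star b = star b * a) {T : B} (hT : T ∈ S) (hT0 : T ≠ 0) :
    ∃ A : StarSubalgebra ℂ B, IsClosed (A : Set B) ∧ ∃ hS : S ⊆ A, ∃ φ : A →ₐ[ℂ] ℂ,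
      (∀ a, ‖φ a‖ ≤ ‖a‖) ∧ φ ⟨T, hS hT⟩ ≠ 0 := by
  have := StarAlgebra.isMulCommutative_adjoin ℂ hcomm hstar
  set A := (StarAlgebra.adjoin ℂ S).topologicalClosure with hA
  have hcl : IsClosed (A : Set B) := StarSubalgebra.isClosed_topologicalClosure _
  have hS : S ⊆ A := (StarAlgebra.subset_adjoin ℂ S).trans
    (StarSubalgebra.le_topologicalClosure _)
  let _ : CommCStarAlgebra A :=
    { (inferInstance : CStarAlgebra A) with
      mul_comm := (StarSubalgebra.commRingTopologicalClosure (StarAlgebra.adjoin ℂ S)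
        (fun x y => Subtype.ext (setLike_mul_comm x.2 y.2))).mul_comm }
  have : Nontrivial A := ⟨⟨T, hS hT⟩, 0, fun h0 => hT0 (congrArg Subtype.val h0)⟩
  -- The Gelfand transform of a commutative C⋆-algebra is isometric, hence injective.
  have h : WeakDual.gelfandTransform ℂ A ⟨T, hS hT⟩ ≠ 0 := by
    intro h0
    have h1 := (gelfandTransform_isometry A).injective (h0.trans (map_zero _).symm)
    exact hT0 (congrArg Subtype.val h1)
  obtain ⟨φ, hφ⟩ := DFunLike.ne_iff.1 h
  exact ⟨A, hcl, hS, WeakDual.CharacterSpace.toAlgHom φ,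
    fun a => AlgHom.norm_apply_le_self _ a, hφ⟩

/-! ### The regular representation and convolution operators on `L²(G)`. -/

section Regular

variable {G : Type*} [CommGroup G] [TopologicalSpace G] [IsTopologicalGroup G] [CompactSpace G]
  [MeasurableSpace G] [BorelSpace G]

variable (G) in
/-- The Hilbert space `L²(G)`. -/
abbrev L2 : Type _ := Lp ℂ 2 (haarProb G)

/-- Translation on `L²(G)`. -/
def translateL2 (t : G) : L2 G →ₗᵢ[ℂ] L2 G where
  toFun g := DomMulAct.mk t⁻¹ • g
  map_add' f g := smul_add _ f g
  map_smul' c g := smul_comm _ c g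
  norm_map' g := DomMulAct.norm_smul_Lp _ g

theorem translateL2_def (t : G) (g : L2 G) : translateL2 t g = DomMulAct.mk t⁻¹ • g := rfl

theorem translateL2_ae_eq (t : G) (g : L2 G) :
    translateL2 t g =ᵐ[haarProb G] fun x => g (t⁻¹ * x) :=
  DomMulAct.smul_Lp_ae_eq (DomMulAct.mk t⁻¹) g

theorem translateL2_mul (s t : G) (g : L2 G) :
    translateL2 (s * t) g = translateL2 s (translateL2 t g) := by
  simp only [translateL2_def, smul_smul, ← DomMulAct.mk_mul]
  rw [mul_inv]
  congr 1
  rw [mul_comm]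

theorem translateL2_one (g : L2 G) : translateL2 1 g = g := by
  simp [translateL2_def]

theorem continuous_translateL2 (g : L2 G) : Continuous fun t : G => translateL2 t g := by
  have h : Continuous fun t : G => DomMulAct.mk t⁻¹ :=
    DomMulAct.continuous_mk.comp continuous_inv
  have : Fact ((2 : ℝ≥0∞) ≠ ∞) := ⟨ENNReal.ofNat_ne_top⟩
  exact h.smul continuous_const

/-- The regular representation of `G` on `L²(G)`. -/
def regRep (t : G) : L2 G →L[ℂ] L2 G := (translateL2 t).toContinuousLinearMap

theorem regRep_apply (t : G) (g : L2 G) : regRep t g = translateL2 t g := rfl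

theorem regRep_mul (s t : G) : regRep (s * t) = regRep s * regRep t :=
  ContinuousLinearMap.ext fun g => translateL2_mul s t g

theorem regRep_one : regRep (1 : G) = 1 := ContinuousLinearMap.ext translateL2_one

theorem regRep_comm (s t : G) : regRep s * regRep t = regRep t * regRep s := by
  rw [← regRep_mul, mul_comm, regRep_mul]

theorem star_regRep (t : G) : star (regRep t) = regRep t⁻¹ := by
  rw [ContinuousLinearMap.star_eq_adjoint, eq_comm, ContinuousLinearMap.eq_adjoint_iff]
  intro f g
  rw [← (translateL2 t).inner_map_map, regRep_apply, ← translateL2_mul, mul_inv_cancel,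
    translateL2_one, regRep_apply]

theorem integrable_smul_translateL2 (f : L1 G) (g : L2 G) :
    Integrable (fun t => f t • translateL2 t g) (haarProb G) :=
  integrable_smul_of_continuous f (continuous_translateL2 g) fun t =>
    ((translateL2 t).norm_map g).le

/-- The action `g ↦ ∫ f(t) τ_t g dt` of `L¹(G)` on `L²(G)`. -/
def convOp : L1 G →L[ℂ] L2 G →L[ℂ] L2 G :=
  LinearMap.mkContinuous₂
    (LinearMap.mk₂ ℂ (fun f g => ∫ t, f t • translateL2 t g ∂(haarProb G))
      (fun f g h => by
        rw [← integral_add (integrable_smul_translateL2 f h) (integrable_smul_translateL2 g h)]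
        refine integral_congr_ae ?_
        filter_upwards [Lp.coeFn_add f g] with t ht
        rw [ht, Pi.add_apply, add_smul])
      (fun c f g => by
        rw [← integral_smul]
        refine integral_congr_ae ?_
        filter_upwards [Lp.coeFn_smul c f] with t ht
        rw [ht, Pi.smul_apply, smul_assoc])
      (fun f g h => by
        rw [← integral_add (integrable_smul_translateL2 f g) (integrable_smul_translateL2 f h)]
        simp only [map_add, smul_add])
      (fun c f g => by
        rw [← integral_smul]
        simp only [map_smul, smul_comm c]))
    1 (fun f g => by
      refine (norm_integral_le_integral_norm _).trans ?_
      simp only [norm_smul, LinearIsometry.norm_map]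
      rw [integral_mul_const, ← L1.norm_eq_integral_norm, one_mul])

theorem convOp_apply (f : L1 G) (g : L2 G) :
    convOp f g = ∫ t, f t • translateL2 t g ∂(haarProb G) := rfl

/-- Invariance of Haar measure moves the translation onto `f`. Consequently `s ↦ τ_s T` is norm
continuous for a convolution operator `T`, although `s ↦ τ_s` need not be. -/
theorem regRep_mul_convOp (s : G) (f : L1 G) :
    regRep s * convOp f = convOp (translate s f) := by
  ext1 g
  rw [mul_apply_eq_comp, convOp_apply, convOp_apply,
    ← ContinuousLinearMap.integral_comp_comm _ (integrable_smul_translateL2 f g),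
    ← integral_mul_left_eq_self (fun t => (translate s f) t • translateL2 t g) s]
  refine integral_congr_ae ?_
  have h := (measurePreserving_mul_left (haarProb G) s).quasiMeasurePreserving.ae_eq
    (translate_ae_eq s f)
  filter_upwards [h] with t ht
  simp only [Function.comp_apply] at ht
  rw [ht, map_smul, translateL2_mul, regRep_apply]
  simp

/-- A convolution operator is an integral of translations. Taking the adjoint of `convOp f` for `B`
will give normality. -/
theorem convOp_comm_of_regRep_comm {B : L2 G →L[ℂ] L2 G}
    (hB : ∀ t, regRep t * B = B * regRep t) (f : L1 G) : convOp f * B = B * convOp f := by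
  ext1 g
  simp only [mul_apply_eq_comp]
  rw [convOp_apply, convOp_apply,
    ← ContinuousLinearMap.integral_comp_comm _ (integrable_smul_translateL2 f g)]
  refine integral_congr_ae (Filter.Eventually.of_forall fun t => ?_)
  have h := DFunLike.congr_fun (hB t) g
  simp only [mul_apply_eq_comp, regRep_apply] at h
  simp only [map_smul, h]

theorem regRep_comm_convOp (t : G) (f : L1 G) : regRep t * convOp f = convOp f * regRep t :=
  (convOp_comm_of_regRep_comm (fun s => regRep_comm s t) f).symm

theorem regRep_comm_star_convOp (t : G) (f : L1 G) :
    regRep t * star (convOp f) = star (convOp f) * regRep t := by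
  have h := congrArg star (regRep_comm_convOp t⁻¹ f)
  simp only [star_mul, star_regRep, inv_inv] at h
  exact h.symm

theorem toLp_two_shift (t : G) (k : C(G, ℂ)) :
    ContinuousMap.toLp 2 (haarProb G) ℂ (shift t k) =
      translateL2 t (ContinuousMap.toLp 2 (haarProb G) ℂ k) := by
  refine Lp.ext ?_
  have h := (measurePreserving_mul_left (haarProb G) t⁻¹).quasiMeasurePreserving.ae_eq
    (ContinuousMap.coeFn_toLp (p := 2) (𝕜 := ℂ) (haarProb G) k)
  filter_upwards [translateL2_ae_eq t (ContinuousMap.toLp 2 (haarProb G) ℂ k), h,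
    ContinuousMap.coeFn_toLp (p := 2) (𝕜 := ℂ) (haarProb G) (shift t k)] with x h1 h2 h3
  rw [h1, h3]
  exact h2.symm

theorem toLp_two_convC (f : L1 G) (k : C(G, ℂ)) :
    ContinuousMap.toLp 2 (haarProb G) ℂ (convC f k) =
      convOp f (ContinuousMap.toLp 2 (haarProb G) ℂ k) := by
  rw [convC, convOp_apply,
    ← ContinuousLinearMap.integral_comp_comm _ (integrable_smul_shift f k)]
  simp only [map_smul, toLp_two_shift]

theorem integrable_smul_mul {A : Type*} [NormedRing A] [NormedAlgebra ℂ A] {u : G → A}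
    (hu : ∀ t, ‖u t‖ ≤ 1) {T : A} (hc : Continuous fun t => u t * T) (f : L1 G) :
    Integrable (fun t => f t • (u t * T)) (haarProb G) :=
  integrable_smul_of_continuous f hc (C := ‖T‖) fun t =>
    (norm_mul_le _ _).trans (mul_le_of_le_one_left (norm_nonneg _) (hu t))

/-- A character of a Banach algebra, restricted to a bounded representation of `G`, yields a
continuous character of `G`. -/
theorem exists_fourier_eq_of_character {A : Type*} [NormedRing A] [NormedAlgebra ℂ A]
    [CompleteSpace A] (φ : A →ₐ[ℂ] ℂ) (hφ : ∀ a, ‖φ a‖ ≤ ‖a‖) (u : G →* A)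
    (hu : ∀ t, ‖u t‖ ≤ 1) {T : A} (hc : Continuous fun t => u t * T) (hT : φ T ≠ 0) (f : L1 G) :
    ∃ γ : PontryaginDual G,
      φ (∫ t, f t • (u t * T) ∂(haarProb G)) = fourier f γ * φ T := by
  let φc : A →L[ℂ] ℂ := LinearMap.mkContinuous φ.toLinearMap 1 fun a => by simpa using hφ a
  have hφc (a : A) : φc a = φ a := rfl
  -- `φ(u t)` and `φ(u t⁻¹)` have modulus at most 1 and product 1.
  have hφu (t : G) : ‖φ (u t)‖ = 1 := by
    have h1 := (hφ (u t)).trans (hu t)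
    have h2 := (hφ (u t⁻¹)).trans (hu t⁻¹)
    have h3 : ‖φ (u t)‖ * ‖φ (u t⁻¹)‖ = 1 := by
      rw [← norm_mul, ← map_mul, ← map_mul, mul_inv_cancel, map_one, map_one, norm_one]
    nlinarith [norm_nonneg (φ (u t)), norm_nonneg (φ (u t⁻¹))]
  -- Only `t ↦ u t * T` is known to be continuous, so `φ(u t)` is written as `φ(u t * T) / φ(T)`.
  have hcont : Continuous fun t => φ (u t) := by
    have h : (fun t => φ (u t)) = fun t => φc (u t * T) / φ T := by
      funext t
      rw [hφc, map_mul, mul_div_cancel_right₀ _ hT]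
    rw [h]
    exact (φc.continuous.comp hc).div_const _
  let γ : G →ₜ* Circle :=
    { toFun := fun t => ⟨φ (u t), mem_sphere_zero_iff_norm.2 (hφu t)⟩
      map_one' := Subtype.ext (by simp)
      map_mul' := fun s t => Subtype.ext ((congrArg φ (map_mul u s t)).trans (map_mul φ _ _))
      continuous_toFun := hcont.subtype_mk _ }
  -- The inverse character is taken because the Fourier transform integrates against the conjugate.
  let γ' : PontryaginDual G := (γ⁻¹ : G →ₜ* Circle)
  have hγ' (t : G) : conj (γ' t : ℂ) = φ (u t) := by
    change conj (((γ t)⁻¹ : Circle) : ℂ) = φ (u t)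
    rw [Circle.coe_inv_eq_conj, Complex.conj_conj]
    rfl
  refine ⟨γ', ?_⟩
  rw [← hφc, ← ContinuousLinearMap.integral_comp_comm _ (integrable_smul_mul hu hc f), fourier,
    ← integral_mul_const]
  refine integral_congr_ae (Filter.Eventually.of_forall fun t => ?_)
  simp only [hφc, hγ', map_smul, map_mul, smul_eq_mul, mul_assoc]

end Regular

/-! ### Uniqueness of Fourier coefficients. -/

section Regular

variable {G : Type*} [CommGroup G] [TopologicalSpace G] [IsTopologicalGroup G] [CompactSpace G]
  [MeasurableSpace G] [BorelSpace G]


variable [T2Space G]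

/-- On a continuous `k`, the `L²` and `L¹` actions of `f` are both represented by the continuous
function `convC f k`. -/
theorem eq_zero_of_convOp_eq_zero {f : L1 G} (h : convOp f = 0) : f = 0 := by
  refine eq_zero_of_conv_eq_zero fun k => ?_
  have h2 : convC f k = 0 := by
    refine ContinuousMap.toLp_injective (p := 2) (𝕜 := ℂ) (haarProb G) ?_
    rw [toLp_two_convC, h, zero_apply, map_zero]
  rw [← toL1_convC, h2, map_zero]

/-- Uniqueness of Fourier coefficients of integrable functions. -/
theorem eq_zero_of_fourier_eq_zero {f : L1 G} (hf : fourier f = 0) : f = 0 := by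
  by_contra hf0
  have hT0 : convOp f ≠ 0 := fun h => hf0 (eq_zero_of_convOp_eq_zero h)
  set T := convOp f with hTdef
  have hstarT : T * star T = star T * T :=
    convOp_comm_of_regRep_comm (fun t => regRep_comm_star_convOp t f) f
  obtain ⟨A, hcl, hS, φ, hφ, hφT⟩ := exists_character_ne_zero
    (S := insert T (Set.range (regRep (G := G)))) (T := T)
    (by
      rintro a (rfl | ⟨s, rfl⟩) b (rfl | ⟨t, rfl⟩)
      · rfl
      · exact (regRep_comm_convOp t f).symm
      · exact regRep_comm_convOp s f
      · exact regRep_comm s t)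
    (by
      rintro a (rfl | ⟨s, rfl⟩) b (rfl | ⟨t, rfl⟩)
      · exact hstarT
      · rw [star_regRep]
        exact (regRep_comm_convOp t⁻¹ f).symm
      · exact regRep_comm_star_convOp s f
      · rw [star_regRep]
        exact regRep_comm s t⁻¹)
    (Set.mem_insert _ _) hT0
  have : CompleteSpace A := hcl.completeSpace_coe
  obtain ⟨T', hT'⟩ : ∃ T' : A, T' = ⟨T, hS (Set.mem_insert _ _)⟩ := ⟨_, rfl⟩
  have hT'c : (T' : L2 G →L[ℂ] L2 G) = T := by rw [hT']
  rw [← hT'] at hφT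
  let u : G →* A :=
    { toFun := fun t => ⟨regRep t, hS (Set.mem_insert_of_mem _ ⟨t, rfl⟩)⟩
      map_one' := Subtype.ext regRep_one
      map_mul' := fun s t => Subtype.ext (regRep_mul s t) }
  have huc (t : G) : (u t : L2 G →L[ℂ] L2 G) = regRep t := rfl
  have hu (t : G) : ‖u t‖ ≤ 1 := (translateL2 t).norm_toContinuousLinearMap_le
  have huT : Continuous fun t => u t * T' := by
    refine continuous_induced_rng.2 ?_
    have h : (Subtype.val ∘ fun t => u t * T') = fun t => convOp (translate t f) := by
      funext t
      rw [← regRep_mul_convOp, ← hTdef, ← huc, ← hT'c]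
      rfl
    rw [h]
    exact convOp.continuous.comp (continuous_translate f)
  -- The left side is a norm-convergent integral in `A`, whereas `convOp` is defined vector by
  -- vector; evaluation at `g` compares them.
  have hTT : ∫ t, f t • (u t * T') ∂(haarProb G) = T' * T' := by
    refine Subtype.ext (ContinuousLinearMap.ext fun g => ?_)
    let ev : A →L[ℂ] L2 G :=
      (ContinuousLinearMap.apply ℂ (L2 G) g).comp A.toSubalgebra.toSubmodule.subtypeL
    have hev (a : A) : ev a = (a : L2 G →L[ℂ] L2 G) g := rfl
    have hev' (t : G) : ev (f t • (u t * T')) = f t • translateL2 t (T g) := by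
      change f t • (regRep t * (T' : L2 G →L[ℂ] L2 G)) g = _
      rw [hT'c]
      rfl
    rw [← hev, ← ContinuousLinearMap.integral_comp_comm _ (integrable_smul_mul hu huT f)]
    simp only [hev', MulMemClass.coe_mul, mul_apply_eq_comp, hT'c]
    rfl
  -- Here `φ(T)² = f̂(γ) φ(T) = 0`, against `φ(T) ≠ 0`.
  obtain ⟨γ, hγ⟩ := exists_fourier_eq_of_character φ hφ u hu huT hφT f
  rw [hTT, hf, Pi.zero_apply, zero_mul, map_mul] at hγ
  exact hφT (mul_self_eq_zero.1 hγ)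

end Regular

/-! ### Comparison of `ℓᵖ` with `ℓ²`, and smallness of terms. -/

section Lp

variable {ι : Type*} {p : ℝ≥0∞} [Fact (1 ≤ p)]

/-- For `1 ≤ p ≤ 2`, the `ℓ²` norm is at most the `ℓᵖ` norm. -/
theorem lp_two_norm_le (hp : p ≤ 2) (a : lp (fun _ : ι => ℂ) p) (b : lp (fun _ : ι => ℂ) 2)
    (hab : ∀ i, b i = a i) : ‖b‖ ≤ ‖a‖ := by
  have hp0 : p ≠ 0 := (zero_lt_one.trans_le (Fact.out : 1 ≤ p)).ne'
  have hpt : p ≠ ∞ := (hp.trans_lt ENNReal.ofNat_lt_top).ne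
  have hr : 0 < p.toReal := ENNReal.toReal_pos hp0 hpt
  have hr2 : p.toReal ≤ 2 := by
    simpa using ENNReal.toReal_mono ENNReal.ofNat_ne_top hp
  have h2 : (2 : ℝ≥0∞).toReal = 2 := by simp
  refine lp.norm_le_of_forall_sum_le (by simp) (norm_nonneg a) fun s => ?_
  -- Splitting off the exponent `2 - p ≥ 0` lets that factor be bounded by its value at the norm
  -- `‖a‖`, leaving a `p`-th power sum.
  have split {y : ℝ} (hy : 0 ≤ y) : y ^ (2 : ℝ) = y ^ p.toReal * y ^ (2 - p.toReal) := by
    rw [← Real.rpow_add_of_nonneg hy hr.le (sub_nonneg.2 hr2), add_sub_cancel]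
  rw [h2, split (norm_nonneg a)]
  calc ∑ i ∈ s, ‖b i‖ ^ (2 : ℝ)
      ≤ ∑ i ∈ s, ‖a i‖ ^ p.toReal * ‖a‖ ^ (2 - p.toReal) := by
        refine Finset.sum_le_sum fun i _ => ?_
        rw [hab, split (norm_nonneg (a i))]
        gcongr
        exact lp.norm_apply_le_norm hp0 a i
    _ = (∑ i ∈ s, ‖a i‖ ^ p.toReal) * ‖a‖ ^ (2 - p.toReal) := (Finset.sum_mul ..).symm
    _ ≤ ‖a‖ ^ p.toReal * ‖a‖ ^ (2 - p.toReal) := by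
        gcongr
        exact lp.sum_rpow_le_norm_rpow hr a s

/-- Terms of a summable family tend to 0 along the cofinite filter, which is nontrivial on an
infinite index set. -/
theorem exists_norm_lp_apply_lt [Infinite ι] (hp : p ≠ ∞) (a : lp (fun _ : ι => ℂ) p) {ε : ℝ}
    (hε : 0 < ε) : ∃ i, ‖a i‖ < ε := by
  have hr : 0 < p.toReal :=
    ENNReal.toReal_pos (zero_lt_one.trans_le (Fact.out : 1 ≤ p)).ne' hp
  have h := ((lp.memℓp a).summable hr).tendsto_cofinite_zero
  obtain ⟨i, hi⟩ := (h.eventually_lt_const (Real.rpow_pos_of_pos hε p.toReal)).exists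
  exact ⟨i, (Real.rpow_lt_rpow_iff (norm_nonneg _) hε.le hr).1 hi⟩

end Lp

/-! ### Characters: orthonormality, synthesis from `ℓ²`, and the size of the dual. -/

section Character

variable {G : Type*} [CommGroup G] [TopologicalSpace G]

/-- A character, as a complex-valued continuous function. -/
def charC (γ : PontryaginDual G) : C(G, ℂ) :=
  ⟨fun x => (γ x : ℂ), continuous_subtype_val.comp (map_continuous γ)⟩

theorem charC_apply (γ : PontryaginDual G) (x : G) : charC γ x = (γ x : ℂ) := rfl

end Character

section Characters

variable {G : Type*} [CommGroup G] [TopologicalSpace G] [IsTopologicalGroup G] [CompactSpace G]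
  [MeasurableSpace G] [BorelSpace G]

/-- A character, as an element of `L²(G)`. -/
def charL2 (γ : PontryaginDual G) : L2 G := ContinuousMap.toLp 2 (haarProb G) ℂ (charC γ)

/-- If `γ t ≠ γ' t`, translation by `t` preserves the integral but multiplies it by a scalar other
than 1. -/
theorem integral_character_mul_conj (γ γ' : PontryaginDual G) [Decidable (γ = γ')] :
    ∫ x, (γ' x : ℂ) * conj (γ x : ℂ) ∂(haarProb G) = if γ = γ' then 1 else 0 := by
  split_ifs with h
  · subst h
    have h1 (x : G) : (γ x : ℂ) * conj (γ x : ℂ) = 1 := by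
      rw [Complex.mul_conj, Circle.normSq_coe, Complex.ofReal_one]
    simp [h1]
  · obtain ⟨t, ht⟩ : ∃ t, γ t ≠ γ' t := by
      by_contra! hc
      exact h (PontryaginDual.ext hc)
    have h1 := integral_mul_left_eq_self (μ := haarProb G)
      (fun x => (γ' x : ℂ) * conj (γ x : ℂ)) t
    have h2 (x : G) : (γ' (t * x) : ℂ) * conj (γ (t * x) : ℂ) =
        ((γ' t : ℂ) * conj (γ t : ℂ)) * ((γ' x : ℂ) * conj (γ x : ℂ)) := by
      simp only [map_mul, Circle.coe_mul]
      ring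
    simp only [h2] at h1
    rw [integral_const_mul] at h1
    by_contra h0
    have h3 : (γ' t : ℂ) * conj (γ t : ℂ) = 1 := mul_right_cancel₀ h0 (h1.trans (one_mul _).symm)
    rw [← Circle.coe_inv_eq_conj, ← Circle.coe_mul, Circle.coe_eq_one, mul_inv_eq_one] at h3
    exact ht h3.symm

theorem inner_charL2 (γ : PontryaginDual G) (h : L2 G) :
    inner ℂ (charL2 γ) h = ∫ x, h x * conj (γ x : ℂ) ∂(haarProb G) := by
  rw [L2.inner_def]
  refine integral_congr_ae ?_
  filter_upwards [ContinuousMap.coeFn_toLp (p := 2) (𝕜 := ℂ) (haarProb G) (charC γ)] with x hx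
  rw [RCLike.inner_apply, charL2, hx, charC_apply]

theorem orthonormal_charL2 : Orthonormal ℂ (charL2 : PontryaginDual G → L2 G) := by
  classical
  rw [orthonormal_iff_ite]
  intro γ γ'
  rw [inner_charL2, ← integral_character_mul_conj]
  refine integral_congr_ae ?_
  filter_upwards [ContinuousMap.coeFn_toLp (p := 2) (𝕜 := ℂ) (haarProb G) (charC γ')] with x hx
  rw [charL2, hx, charC_apply]

/-- Every square-summable family is the family of Fourier coefficients of a function whose `L¹`
norm is at most the `ℓ²` norm of the family. -/
theorem exists_fourier_eq (a : lp (fun _ : PontryaginDual G => ℂ) 2) :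
    ∃ g : L1 G, fourier g = a ∧ ‖g‖ ≤ ‖a‖ := by
  classical
  have hV := (orthonormal_charL2 (G := G)).orthogonalFamily
  -- This is the `L²`-convergent sum `∑ a_γ γ`. Only orthonormality is needed for it, not
  -- completeness of the characters.
  set h : L2 G := hV.linearIsometry a with hh
  have h1 : MemLp h 1 (haarProb G) := (Lp.memLp h).mono_exponent one_le_two
  refine ⟨h1.toLp h, ?_, ?_⟩
  · funext γ
    have h2 : fourier (h1.toLp h) γ = inner ℂ (charL2 γ) h := by
      rw [inner_charL2]
      refine integral_congr_ae ?_
      filter_upwards [h1.coeFn_toLp] with x hx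
      rw [hx]
    have h3 : charL2 γ = hV.linearIsometry (lp.single 2 γ (1 : ℂ)) := by
      rw [hV.linearIsometry_apply_single]
      simp
    rw [h2, h3, hh, LinearIsometry.inner_map_map, lp.inner_single_left]
    simp
  -- On a space of total mass 1 the `L¹` norm is at most the `L²` norm.
  · rw [← hV.linearIsometry.norm_map a, ← hh, Lp.norm_toLp, Lp.norm_def]
    exact ENNReal.toReal_mono (Lp.eLpNorm_ne_top h)
      (eLpNorm_le_eLpNorm_of_exponent_le one_le_two (Lp.aestronglyMeasurable h))

variable [T2Space G]

theorem fourier_injective : Function.Injective (fourier : L1 G → PontryaginDual G → ℂ) := by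
  intro f g h
  have h1 : fourier (f + (-1 : ℂ) • g) = 0 := by
    rw [fourier_add, fourier_smul, h]
    simp
  have h2 := eq_zero_of_fourier_eq_zero h1
  rwa [neg_one_smul, ← sub_eq_add_neg, sub_eq_zero] at h2

/-- A compact abelian group with finite dual is discrete. -/
theorem discreteTopology_of_finite_dual [Finite (PontryaginDual G)] : DiscreteTopology G := by
  -- With `n = |Ĝ|`, `γⁿ = 1`, so `γ` has values among the finitely many `n`-th roots of unity, and
  -- its kernel is the complement of a closed preimage.
  have hker (γ : PontryaginDual G) : IsOpen {x : G | γ x = 1} := by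
    have hfin : {z : Circle | z ^ Nat.card (PontryaginDual G) = 1}.Finite := by
      refine Set.Finite.of_finite_image (f := ((↑) : Circle → ℂ)) ?_ Circle.coe_injective.injOn
      refine (Polynomial.nthRoots (Nat.card (PontryaginDual G)) (1 : ℂ)).toFinset.finite_toSet.subset
        ?_
      rintro _ ⟨z, hz, rfl⟩
      simp only [Set.mem_ofPred_eq] at hz
      simp only [Finset.mem_coe, Multiset.mem_toFinset]
      rw [Polynomial.mem_nthRoots Nat.card_pos, ← Circle.coe_pow, hz, Circle.coe_one]
    have heq : {x : G | γ x = 1} =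
        (γ ⁻¹' ({z : Circle | z ^ Nat.card (PontryaginDual G) = 1} \ {1}))ᶜ := by
      ext x
      have : γ x ^ Nat.card (PontryaginDual G) = 1 := by
        have hpow (n : ℕ) : (γ ^ n) x = γ x ^ n := by
          induction n with
          | zero => rfl
          | succ n ih => rw [pow_succ, pow_succ, ← ih]; rfl
        rw [← hpow, pow_card_eq_one', PontryaginDual.one_apply]
      simp [this]
    rw [heq]
    exact ((hfin.subset Set.sdiff_subset).isClosed.preimage (map_continuous γ)).isOpen_compl
  have hK : IsOpen (⋂ γ : PontryaginDual G, {x : G | γ x = 1}) := isOpen_iInter_of_finite hker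
  have hK1 : (⋂ γ : PontryaginDual G, {x : G | γ x = 1}) = {1} := by
    ext t
    simp only [Set.mem_iInter, Set.mem_ofPred_eq, Set.mem_singleton_iff]
    refine ⟨fun ht => ?_, fun ht γ => by rw [ht, map_one]⟩
    -- Translation by `t` multiplies the coefficient at `γ` by the conjugate of `γ t = 1`, so
    -- uniqueness applies.
    have htr (k : C(G, ℂ)) : shift t k = k := by
      refine ContinuousMap.toLp_injective (p := 1) (𝕜 := ℂ) (haarProb G) ?_
      change toL1 _ = toL1 _
      rw [toL1_shift]
      refine fourier_injective (funext fun γ => ?_)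
      rw [fourier_translate, ht γ]
      simp
    -- A Urysohn function separating `t` from `1` is not fixed by translation by `t`.
    by_contra hne
    obtain ⟨k, hk0, hk1, -⟩ := exists_continuous_zero_one_of_isClosed
      (isClosed_singleton (x := t)) (isClosed_singleton (x := (1 : G))) (by simpa using hne)
    have h := DFunLike.congr_fun (htr ((Complex.ofRealCLM : C(ℝ, ℂ)).comp k)) t
    rw [shift_apply, inv_mul_cancel] at h
    simp [hk0 (Set.mem_singleton t), hk1 (Set.mem_singleton (1 : G))] at h
  exact discreteTopology_of_isOpen_singleton_one (hK1 ▸ hK)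

end Characters

/-! ### Transforms on `A_p(G)` and its unitization. -/

section Inverse

variable {G : Type*} [CommGroup G] [TopologicalSpace G] [IsTopologicalGroup G] [CompactSpace G]
  [MeasurableSpace G] [BorelSpace G] {p : ℝ≥0∞}

theorem Ap.hat_mul_apply (f g : Ap G p) (γ : PontryaginDual G) :
    (f * g).hat γ = f.hat γ * g.hat γ := congrFun (fourier_conv f.toL1 g.toL1) γ

theorem Ap.hat_injective [T2Space G] : Function.Injective (Ap.hat : Ap G p → _) := fun _ _ h =>
  Ap.toL1_injective (fourier_injective (congrArg Subtype.val h))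
variable [Fact (1 ≤ p)]

/-- For `p ≤ 2`, every `a ∈ ℓᵖ` is the Fourier transform of some `g ∈ A_p(G)` with
`‖g‖ ≤ 2 ‖a‖_p`. -/
theorem Ap.exists_hat_eq (hp : p ≤ 2) (a : lp (fun _ : PontryaginDual G => ℂ) p) :
    ∃ g : Ap G p, g.hat = a ∧ ‖g‖ ≤ 2 * ‖a‖ := by
  let b : lp (fun _ : PontryaginDual G => ℂ) 2 := ⟨a, (lp.memℓp a).of_exponent_ge hp⟩
  obtain ⟨g, hg, hgn⟩ := exists_fourier_eq b
  let g' : Ap G p := ⟨g, by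
    change Memℓp (fourier g) p
    rw [hg]
    exact lp.memℓp a⟩
  have h : g'.hat = a := lp.ext hg
  refine ⟨g', h, ?_⟩
  rw [Ap.norm_def, h, two_mul]
  exact add_le_add_left (hgn.trans (lp_two_norm_le hp a b fun _ => rfl)) _

theorem ApUnit.norm_eq (x : ApUnit G p) : ‖x‖ = ‖x.ofLp.fst‖ + ‖x.ofLp.snd‖ :=
  WithLp.unitization_norm_def x

theorem ApUnit.hat_mul (x y : ApUnit G p) (γ : PontryaginDual G) :
    (x * y).hat γ = x.hat γ * y.hat γ := by
  simp only [ApUnit.hat, WithLp.unitization_mul, Unitization.fst_mul, Unitization.snd_mul,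
    map_add, map_smul, lp.coeFn_add, lp.coeFn_smul, Pi.add_apply, Pi.smul_apply, smul_eq_mul,
    Ap.hat_mul_apply]
  ring

theorem ApUnit.hat_one (γ : PontryaginDual G) : (1 : ApUnit G p).hat γ = 1 := by
  change (1 : ℂ) + (Ap.hat (0 : Ap G p)) γ = 1
  rw [map_zero, lp.coeFn_zero, Pi.zero_apply, add_zero]

variable [T2Space G]

-- The scalar parts are compared separately: were `Ĝ` finite, `x̂` alone would not determine `x`.
omit [Fact (1 ≤ p)] in
theorem ApUnit.ext_hat {x y : ApUnit G p} (h1 : x.ofLp.fst = y.ofLp.fst)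
    (h2 : ∀ γ, x.hat γ = y.hat γ) : x = y := by
  refine WithLp.ofLp_injective 1
    (Unitization.ext h1 (Ap.hat_injective (lp.ext (funext fun γ => ?_))))
  have h := h2 γ
  rw [ApUnit.hat, ApUnit.hat, h1] at h
  exact add_left_cancel h

theorem ApUnit.mul_eq_one {x y : ApUnit G p} (h1 : x.ofLp.fst * y.ofLp.fst = 1)
    (h2 : ∀ γ, x.hat γ * y.hat γ = 1) : x * y = 1 :=
  ApUnit.ext_hat h1 fun γ => by rw [ApUnit.hat_mul, ApUnit.hat_one, h2]

/-- The scalar part is a limit of values of `x̂`, because `Ĝ` is infinite and `f̂` takes arbitrarily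
small values. -/
theorem ApUnit.le_norm_fst (hG : ¬ DiscreteTopology G) (hp : p ≠ ∞) {x : ApUnit G p} {δ : ℝ}
    (hxδ : ∀ γ : PontryaginDual G, δ ≤ ‖x.hat γ‖) : δ ≤ ‖x.ofLp.fst‖ := by
  have : Infinite (PontryaginDual G) :=
    not_finite_iff_infinite.1 fun _ => hG discreteTopology_of_finite_dual
  refine le_of_forall_pos_le_add fun ε hε => ?_
  obtain ⟨γ, hγ⟩ := exists_norm_lp_apply_lt hp x.ofLp.snd.hat hε
  exact (hxδ γ).trans ((norm_add_le _ _).trans (add_le_add_right hγ.le _))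

end Inverse

end FourierAlgebra

end

/-! ### Construction of the inverse and its norm estimate. -/

theorem mainTheorem2 {G : Type*} [CommGroup G] [TopologicalSpace G] [IsTopologicalGroup G]
    [T2Space G] [CompactSpace G] (hG : ¬ DiscreteTopology G) [MeasurableSpace G] [BorelSpace G]
    (p : ENNReal) [Fact (1 ≤ p)] (hp : p ≤ 2)
    (x : FourierAlgebra.ApUnit G p) (hx : ‖x‖ ≤ 1)
    (δ : ℝ) (hδ : 0 < δ) (hxδ : ∀ γ : PontryaginDual G, δ ≤ ‖x.hat γ‖) :
    IsUnit x ∧ ‖Ring.inverse x‖ ≤ 1 / δ + 2 * (1 - δ) / δ ^ 2 := by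
  have hp0 : p ≠ 0 := (zero_lt_one.trans_le (Fact.out : 1 ≤ p)).ne'
  have hc := FourierAlgebra.ApUnit.le_norm_fst hG (hp.trans_lt ENNReal.ofNat_lt_top).ne hxδ
  set c := x.ofLp.fst with hcdef
  set f := x.ofLp.snd with hfdef
  have hc0 : c ≠ 0 := norm_pos_iff.1 (hδ.trans_le hc)
  have hx0 (γ : PontryaginDual G) : x.hat γ ≠ 0 := norm_pos_iff.1 (hδ.trans_le (hxδ γ))
  -- From `|c| + ‖f‖₁ + ‖f̂‖_p ≤ 1` and `|c| ≥ δ`.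
  have hf : ‖f.hat‖ ≤ 1 - δ := by
    rw [FourierAlgebra.ApUnit.norm_eq, FourierAlgebra.Ap.norm_def] at hx
    linarith [norm_nonneg f.toL1]
  let a : PontryaginDual G → ℂ := fun γ => (x.hat γ)⁻¹ - c⁻¹
  -- Since `a = -f̂/(c x̂)`, each of `c` and `x̂` contributes one factor `1/δ`; the domination also
  -- places `a` in `ℓᵖ`.
  have ha (γ : PontryaginDual G) : ‖a γ‖ ≤ ‖(((δ ^ 2)⁻¹ : ℝ) : ℂ) • f.hat γ‖ := by
    have h : a γ = -(f.hat γ) * ((x.hat γ)⁻¹ * c⁻¹) := by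
      have h1 : f.hat γ = x.hat γ - c := by simp [FourierAlgebra.ApUnit.hat, hcdef, hfdef]
      have h2 := hx0 γ
      simp only [a]
      rw [h1]
      field_simp
      ring
    rw [h, norm_mul, norm_neg, norm_mul, norm_inv, norm_inv, norm_smul, Complex.norm_real,
      Real.norm_of_nonneg (by positivity), mul_comm, sq, mul_inv]
    gcongr
    exact hxδ γ
  let a' : lp (fun _ : PontryaginDual G => ℂ) p :=
    ⟨a, ((lp.memℓp f.hat).const_smul (((δ ^ 2)⁻¹ : ℝ) : ℂ)).mono' ha⟩
  have ha' : ‖a'‖ ≤ (δ ^ 2)⁻¹ * (1 - δ) := by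
    have h : ‖a'‖ ≤ ‖(((δ ^ 2)⁻¹ : ℝ) : ℂ) • f.hat‖ := lp.norm_mono hp0 ha
    rw [norm_smul, Complex.norm_real, Real.norm_of_nonneg (by positivity)] at h
    exact h.trans (by gcongr)
  obtain ⟨g, hg, hgn⟩ := FourierAlgebra.Ap.exists_hat_eq hp a'
  let y : FourierAlgebra.ApUnit G p := WithLp.toLp 1 (Unitization.inl c⁻¹ + Unitization.inr g)
  have hy1 : y.ofLp.fst = c⁻¹ := by simp [y]
  have hy2 : y.ofLp.snd = g := by simp [y]
  have hyhat (γ : PontryaginDual G) : y.hat γ = (x.hat γ)⁻¹ := by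
    rw [FourierAlgebra.ApUnit.hat, hy1, hy2, hg]
    exact add_sub_cancel _ _
  have hxy : x * y = 1 := FourierAlgebra.ApUnit.mul_eq_one
    (by rw [hy1, mul_inv_cancel₀ hc0]) fun γ => by rw [hyhat, mul_inv_cancel₀ (hx0 γ)]
  have hyx : y * x = 1 := FourierAlgebra.ApUnit.mul_eq_one
    (by rw [hy1, inv_mul_cancel₀ hc0]) fun γ => by rw [hyhat, inv_mul_cancel₀ (hx0 γ)]
  let u : (FourierAlgebra.ApUnit G p)ˣ := ⟨x, y, hxy, hyx⟩
  refine ⟨u.isUnit, ?_⟩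
  have hu : Ring.inverse x = y := Ring.inverse_unit u
  rw [hu, FourierAlgebra.ApUnit.norm_eq, hy1, hy2, norm_inv, one_div]
  refine add_le_add (inv_anti₀ hδ hc) (hgn.trans ?_)
  calc 2 * ‖a'‖ ≤ 2 * ((δ ^ 2)⁻¹ * (1 - δ)) := by gcongr
    _ = 2 * (1 - δ) / δ ^ 2 := by ring
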